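/- Let $T>0$, let $b:\mathbb{R}^{d_x}\to\mathbb{R}^{d_x}$, $G:\mathbb{R}^{d_x}\to\mathbb{R}^{d_x\times d_u}$, $c,f:\mathbb{R}^{d_x}\to\mathbb{R}$ be continuously differentiable, let $R\in\mathbb{R}^{d_u\times d_u}$ be symmetric positive definite and $\Sigma\in\mathbb{R}^{d_x\times d_x}$ symmetric positive semidefinite (possibly $0$), and put $\|u\|_R^2=u^{\rm T}R^{-1}u$ and, for $g$ scalar or (componentwise) vector valued, $\mathcal{L}_\beta g=\beta\cdot\nabla_x g+\tfrac12\Sigma:D_x^2g$. Let $v$ be a classical solution on $[0,T]\times\mathbb{R}^{d_x}$ of the HJB equation $$-\partial_t v_t=b\cdot\nabla_x v_t+\tfrac12\Sigma:D_x^2v_t+c-\tfrac12\|RG^{\rm T}\nabla_xv_t\|_R^2,\qquad v_T=f,$$ that is, $v$ is continuous on $[0,T]\times\mathbb{R}^{d_x}$, and for $0<t<T$ it is $C^2$ in $x$, differentiable in $t$ and satisfies the equation. Let $\beta_t(a)\in\mathbb{R}^{d_x}$ be an arbitrary gauge variable, and let $X_t(a),P_t(a)$ (continuous in $t\in[0,T]$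 for each label $a\in\mathbb{R}^{d_x}$) and $\phi_t(x)$ satisfy, for all $a$, the mean-field Hamiltonian equations of motion $$\dot X_t=b(X_t)-G(X_t)RG(X_t)^{\rm T}P_t-\beta_t,$$ $$-\dot P_t=(D_xb(X_t))^{\rm T}P_t-\tfrac12\nabla_x\|RG(X_t)^{\rm T}P_t\|_R^2+\nabla_xc(X_t)+\mathcal{L}_{\beta_t}\nabla_x\phi_t(X_t)$$ for $0<t<T$ (in $\nabla_x\|RG^{\rm T}P_t\|_R^2$ the vector $P_t$ is held fixed), the boundary conditions $X_0(a)=a$, $P_T(a)=\nabla_xf(X_T(a))$, and for $0\le t\le T$ the constraint $\nabla_x\phi_t(X_t(a))=P_t(a)$. Suppose that the constraint determines $\nabla_x\phi_t$ everywhere, that is, $a\mapsto X_t(a)$ maps onto $\mathbb{R}^{d_x}$ for every $t\in[0,T]$; that $\nabla_x\phi_t(x)$ exists and is jointly continuous in $(t,x)$ on $[0,T]\times\mathbb{R}^{d_x}$; and that for $0<t<T$ the function $\phi_t$ is $C^3$ in $x$ with second and third derivatives jointly continuous in $(t,x)$. Suppose finally that for $\psi=v$ and for $\psi=\phi$ there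 are $K\in\mathbb{R}$ and $m\in\mathbb{N}$ such that for all $0<t<T$ and all $x$ $$\|\nabla_x\psi_t(x)\|\le K(1+\|x\|)^m,\qquad x\cdot\bigl(b(x)-G(x)RG(x)^{\rm T}\nabla_x\psi_t(x)\bigr)\le K(1+\|x\|^2).$$ Then, whatever the gauge variable $\beta_t$, for all $t\in[0,T]$ and $x\in\mathbb{R}^{d_x}$ the function $v_t$ is differentiable at $x$ and $$\nabla_x\phi_t(x)=\nabla_xv_t(x).$$ -/

import Mathlib

open Set Matrix

noncomputable section

/-- Euclidean space of column vectors of length `n`. -/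
abbrev Vec (n : ℕ) : Type := EuclideanSpace ℝ (Fin n)

/-- The matrix-vector product, between Euclidean spaces. -/
def mulV {m n : ℕ} (A : Matrix (Fin m) (Fin n) ℝ) (u : Vec n) : Vec m :=
  WithLp.toLp 2 (A *ᵥ u.ofLp)

/-- The squared weighted norm `‖u‖²_R = uᵀ R⁻¹ u`. -/
def weightedNormSq {n : ℕ} (R : Matrix (Fin n) (Fin n) ℝ) (u : Vec n) : ℝ :=
  u.ofLp ⬝ᵥ (R⁻¹ *ᵥ u.ofLp)

/-- `A : D²g = ∑ i j, A i j ∂ᵢ∂ⱼ g`, for scalar or (componentwise) vector-valued `g`. -/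
def frobHess {n : ℕ} {F : Type*} [NormedAddCommGroup F] [NormedSpace ℝ F]
    (A : Matrix (Fin n) (Fin n) ℝ) (g : Vec n → F) (x : Vec n) : F :=
  ∑ i, ∑ j, A i j • iteratedFDeriv ℝ 2 g x
    ![EuclideanSpace.single i (1 : ℝ), EuclideanSpace.single j (1 : ℝ)]

/-- The generator `L_β g = β · ∇g + (1/2) A : D²g`, for scalar or (componentwise)
vector-valued `g`. -/
def generator {n : ℕ} {F : Type*} [NormedAddCommGroup F] [NormedSpace ℝ F]
    (A : Matrix (Fin n) (Fin n) ℝ) (β : Vec n) (g : Vec n → F) (x : Vec n) : F :=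
  fderiv ℝ g x β + (1 / 2 : ℝ) • frobHess A g x

/-- The data of the optimal control problem with dynamics
`dX = b(X) dt + G(X) U dt + Sig^{1/2} dB`, running cost `c(X) + (1/2) Uᵀ R⁻¹ U` and terminal
cost `f`. The diffusion matrix may be degenerate, and may vanish. -/
structure ControlProblem (dx du : ℕ) where
  /-- drift -/
  b : Vec dx → Vec dx
  /-- control matrix -/
  G : Vec dx → Matrix (Fin dx) (Fin du) ℝ
  /-- control weight -/
  R : Matrix (Fin du) (Fin du) ℝ
  /-- diffusion matrix -/
  Sig : Matrix (Fin dx) (Fin dx) ℝ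
  /-- running cost -/
  c : Vec dx → ℝ
  /-- terminal cost -/
  f : Vec dx → ℝ
  contDiff_b : ContDiff ℝ 1 b
  contDiff_G : ∀ i j, ContDiff ℝ 1 (fun x => G x i j)
  contDiff_c : ContDiff ℝ 1 c
  contDiff_f : ContDiff ℝ 1 f
  posDef_R : R.PosDef
  posSemidef_Sig : Sig.PosSemidef

namespace ControlProblem

variable {dx du : ℕ} (S : ControlProblem dx du)

/-- `R G(x)ᵀ p`; the control associated with the momentum `p` at `x` is its negative. -/
def RGt (x p : Vec dx) : Vec du :=
  mulV S.R (mulV (S.G x)ᵀ p)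

/-- `G(x) R G(x)ᵀ p`. -/
def GRGt (x p : Vec dx) : Vec dx :=
  mulV (S.G x) (S.RGt x p)

/-- The right-hand side of the HJB equation
`-∂ₜ v = b · ∇v + (1/2) Sig : D²v + c - (1/2) ‖R Gᵀ ∇v‖²_R`. -/
def hjbRHS (v : Vec dx → ℝ) (x : Vec dx) : ℝ :=
  inner ℝ (S.b x) (gradient v x) + (1 / 2) * frobHess S.Sig v x + S.c x
    - (1 / 2) * weightedNormSq S.R (S.RGt x (gradient v x))

/-- `v` is a classical solution of the HJB equation on `[0, T]` with terminal value `f`. -/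
structure IsHJBSolution (T : ℝ) (v : ℝ → Vec dx → ℝ) : Prop where
  continuousOn : ContinuousOn (fun z : ℝ × Vec dx => v z.1 z.2) (Icc 0 T ×ˢ univ)
  contDiff : ∀ t ∈ Ioo 0 T, ContDiff ℝ 2 (v t)
  hjb : ∀ t ∈ Ioo 0 T, ∀ x, HasDerivAt (fun s => v s x) (-S.hjbRHS (v t) x) t
  terminal : ∀ x, v T x = S.f x

/-- Growth class: `∇ψ` grows at most polynomially, and the closed loop drift `b + G u` of the
feedback law `u_t(x) = -R G(x)ᵀ ∇ψ_t(x)` satisfies the one-sided linear growth (non-explosion)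
condition, both uniformly in time. -/
def HasAdmissibleGrowth (T : ℝ) (ψ : ℝ → Vec dx → ℝ) : Prop :=
  ∃ (K : ℝ) (m : ℕ), ∀ t ∈ Ioo 0 T, ∀ x,
    ‖gradient (ψ t) x‖ ≤ K * (1 + ‖x‖) ^ m ∧
    inner ℝ x (S.b x - S.GRGt x (gradient (ψ t) x)) ≤ K * (1 + ‖x‖ ^ 2)

end ControlProblem

/-- Regularity in which the equations of motion are meaningful: `φ_t` is `C³` in `x` for
`0 < t < T`, with second and third derivatives jointly continuous in `(t, x)`, and `∇φ_t(x)`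
exists and is jointly continuous for `0 ≤ t ≤ T`. No regularity in time of `φ` itself is asked
for, since it is determined only up to a function of time. -/
structure IsRegularPotential {dx : ℕ} (T : ℝ) (φ : ℝ → Vec dx → ℝ) : Prop where
  differentiable : ∀ t ∈ Icc 0 T, Differentiable ℝ (φ t)
  continuousOn_gradient :
    ContinuousOn (fun z : ℝ × Vec dx => gradient (φ z.1) z.2) (Icc 0 T ×ˢ univ)
  contDiff : ∀ t ∈ Ioo 0 T, ContDiff ℝ 3 (φ t)
  continuousOn_second :
    ContinuousOn (fun z : ℝ × Vec dx => iteratedFDeriv ℝ 2 (φ z.1) z.2) (Ioo 0 T ×ˢ univ)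
  continuousOn_third :
    ContinuousOn (fun z : ℝ × Vec dx => iteratedFDeriv ℝ 3 (φ z.1) z.2) (Ioo 0 T ×ˢ univ)

/-- `(X, P)` solves the mean-field Hamiltonian equations of motion with gauge variable `β` (all
three indexed by time and by the label `a`), boundary conditions `X_0(a) = a`,
`P_T(a) = ∇f(X_T(a))`, and `φ` is coupled to them through the constraint
`∇φ_t(X_t(a)) = P_t(a)`. In the equation for `P` the gradient of `‖R G(x)ᵀ p‖²_R` is taken in `x`
with `p` fixed. -/
structure IsMeanFieldHamiltonianFlow {dx du : ℕ} (S : ControlProblem dx du) (T : ℝ)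
    (β X P : ℝ → Vec dx → Vec dx) (φ : ℝ → Vec dx → ℝ) : Prop where
  continuousOn_X : ∀ a, ContinuousOn (fun t => X t a) (Icc 0 T)
  continuousOn_P : ∀ a, ContinuousOn (fun t => P t a) (Icc 0 T)
  eqn_X : ∀ t ∈ Ioo 0 T, ∀ a,
    HasDerivAt (fun s => X s a) (S.b (X t a) - S.GRGt (X t a) (P t a) - β t a) t
  eqn_P : ∀ t ∈ Ioo 0 T, ∀ a,
    HasDerivAt (fun s => P s a)
      (-((fderiv ℝ S.b (X t a)).adjoint (P t a)
        - (1 / 2 : ℝ) • gradient (fun x => weightedNormSq S.R (S.RGt x (P t a))) (X t a)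
        + gradient S.c (X t a)
        + generator S.Sig (β t a) (fun x => gradient (φ t) x) (X t a))) t
  initial : ∀ a, X 0 a = a
  terminal : ∀ a, P T a = gradient S.f (X T a)
  constraint : ∀ t ∈ Icc 0 T, ∀ a, gradient (φ t) (X t a) = P t a

end

/-! The gauge variable is only a choice of how the labels move. Differentiating `∇φ_t(X_t) = P_t` in
time, the term `-β` in the velocity contributes `-D²φ β` through the chain rule, and the generator
in the momentum equation contributes the same `-D²φ β`; they cancel. Since `X_t` is onto, what
remains holds at every point: `∇φ` satisfies the spatial gradient of the HJB equation
(`hasDerivAt_fderiv_potential`). Integrating along segments, the differences `φ_t(x) - φ_t(y)`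
satisfy differences of the HJB equation; `φ` itself is known only up to a function of time.

For `w = v - φ` the quadratic terms factor as a difference of squares, so `-∂ₜw = L w` modulo
functions of time, where the drift of `L` is the average of the closed-loop drifts of `v` and `φ`
(`hjbRHS_sub`). It inherits their one-sided growth bound, and `w_T` is constant because both
terminal gradients are `∇f`.

Uniqueness for this linear, possibly degenerate equation is a maximum principle with doubled space
variables (`eq_of_backward_parabolic`): it is run on `w(s,a) - w(s,b)`, which is blind to functions
of time, and a Lyapunov function confines the maximum to a ball. Hence `w_t` is constant in space,
and the gradients agree. -/

/-! ### Second derivatives and local maxima -/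

section SecondOrder

variable {E F : Type*} [NormedAddCommGroup E] [NormedSpace ℝ E] [NormedAddCommGroup F]
  [NormedSpace ℝ F]

theorem ContDiff.hasFDerivAt_fderiv_apply {g : E → F} (hg : ContDiff ℝ 2 g) (x y : E) :
    HasFDerivAt (fun u => fderiv ℝ g u y) ((fderiv ℝ (fderiv ℝ g) x).flip y) x := by
  have h : DifferentiableAt ℝ (fderiv ℝ g) x :=
    ((hg.fderiv_right (m := 1) (by norm_num)).differentiable (by norm_num)) x
  simpa using h.hasFDerivAt.clm_apply (hasFDerivAt_const y x)

theorem ContDiff.fderiv_fderiv_comm {g : E → F} (hg : ContDiff ℝ 2 g) (x y z : E) :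
    fderiv ℝ (fderiv ℝ g) x y z = fderiv ℝ (fderiv ℝ g) x z y :=
  (hg.contDiffAt.isSymmSndFDerivAt (by simp)) y z

theorem ContDiff.hasDerivAt_comp_line {g : E → F} (hg : ContDiff ℝ 1 g) (x y : E) (s : ℝ) :
    HasDerivAt (fun r : ℝ => g (x + r • y)) (fderiv ℝ g (x + s • y) y) s := by
  have h1 : HasDerivAt (fun r : ℝ => x + r • y) y s := by
    simpa using ((hasDerivAt_id s).smul_const y).const_add x
  exact (hg.differentiable (by norm_num) (x + s • y)).hasFDerivAt.comp_hasDerivAt s h1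

/-- Were the second derivative along `y` positive, the restriction to that line would have a local
minimum as well as a local maximum, hence be locally constant, with zero second derivative. -/
theorem fderiv_fderiv_self_nonpos_of_isLocalMax {g : E → ℝ} (hg : ContDiff ℝ 2 g) {x : E}
    (hx : IsLocalMax g x) (y : E) : fderiv ℝ (fderiv ℝ g) x y y ≤ 0 := by
  by_contra! hpos
  have hline : ∀ s : ℝ, HasDerivAt (fun r : ℝ => g (x + r • y)) (fderiv ℝ g (x + s • y) y) s :=
    (hg.of_le (by norm_num)).hasDerivAt_comp_line x y
  have hd : deriv (fun r : ℝ => g (x + r • y)) = fun s => fderiv ℝ g (x + s • y) y :=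
    funext fun s => (hline s).deriv
  have hl : HasDerivAt (fun r : ℝ => x + r • y) y 0 := by
    simpa using ((hasDerivAt_id (0 : ℝ)).smul_const y).const_add x
  have hdd : HasDerivAt (deriv (fun r : ℝ => g (x + r • y))) (fderiv ℝ (fderiv ℝ g) x y y) 0 := by
    rw [hd]
    have h2 := (hg.hasFDerivAt_fderiv_apply (x + (0 : ℝ) • y) y).comp_hasDerivAt 0 hl
    simp only [zero_smul, add_zero] at h2
    exact h2
  have hcont : ContinuousAt (fun r : ℝ => x + r • y) 0 := hl.continuousAt
  have hmax : IsLocalMax (fun r : ℝ => g (x + r • y)) 0 := by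
    have : Filter.Tendsto (fun r : ℝ => x + r • y) (nhds 0) (nhds x) := by
      simpa using hcont.tendsto
    have h3 := this.eventually hx
    filter_upwards [h3] with r hr
    simpa using hr
  have hmin : IsLocalMin (fun r : ℝ => g (x + r • y)) 0 :=
    isLocalMin_of_deriv_deriv_pos (by rw [hdd.deriv]; exact hpos) hmax.deriv_eq_zero
      (hline 0).continuousAt
  have hconst : (fun r : ℝ => g (x + r • y)) =ᶠ[nhds 0] fun _ => g (x + (0 : ℝ) • y) := by
    filter_upwards [hmax, hmin] with r h1 h2 using le_antisymm h1 h2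
  have h0 : deriv (deriv (fun r : ℝ => g (x + r • y))) 0 = 0 := by
    rw [hconst.deriv.deriv_eq]
    simp
  rw [hdd.deriv] at h0
  exact hpos.ne' h0

end SecondOrder

/-! ### The generator with a degenerate diffusion matrix -/

section Generator

variable {n : ℕ}

theorem frobHess_eq_sum_fderiv {F : Type*} [NormedAddCommGroup F] [NormedSpace ℝ F]
    (A : Matrix (Fin n) (Fin n) ℝ) (g : Vec n → F) (x : Vec n) :
    frobHess A g x = ∑ i, ∑ j, A i j • fderiv ℝ (fderiv ℝ g) x
      (EuclideanSpace.single i (1 : ℝ)) (EuclideanSpace.single j (1 : ℝ)) := by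
  simp [frobHess, iteratedFDeriv_two_apply]

theorem Vec.eq_sum_smul_single (y : Vec n) :
    y = ∑ i, y i • EuclideanSpace.single i (1 : ℝ) := by
  ext j
  simp [Finset.sum_apply, Pi.single_apply]

theorem frobHess_vecMulVec (b : Fin n → ℝ) {F : Type*} [NormedAddCommGroup F] [NormedSpace ℝ F]
    (g : Vec n → F) (x : Vec n) :
    frobHess (vecMulVec b b) g x
      = fderiv ℝ (fderiv ℝ g) x (WithLp.toLp 2 b) (WithLp.toLp 2 b) := by
  conv_rhs => rw [Vec.eq_sum_smul_single (WithLp.toLp 2 b)]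
  rw [frobHess_eq_sum_fderiv]
  simp only [map_sum, map_smul, _root_.sum_apply, _root_.smul_apply, Finset.smul_sum, smul_smul,
    vecMulVec_apply]
  rw [Finset.sum_comm]
  simp only [mul_comm]

theorem frobHess_sum {ι F : Type*} [NormedAddCommGroup F] [NormedSpace ℝ F] (s : Finset ι)
    (A : ι → Matrix (Fin n) (Fin n) ℝ) (g : Vec n → F) (x : Vec n) :
    frobHess (∑ k ∈ s, A k) g x = ∑ k ∈ s, frobHess (A k) g x := by
  simp only [frobHess, Matrix.sum_apply, Finset.sum_smul]
  rw [Finset.sum_comm (s := s)]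
  refine Finset.sum_congr rfl fun i _ => ?_
  rw [Finset.sum_comm]

/-- A positive semidefinite matrix is a sum of rank-one terms `b bᵀ`, each of which contributes a
pure second derivative. No ellipticity is needed. -/
theorem frobHess_eq_sum_fderiv_self {A : Matrix (Fin n) (Fin n) ℝ} (hA : A.PosSemidef) :
    ∃ (m : ℕ) (b : Fin m → Vec n), ∀ (g : Vec n → ℝ) (x : Vec n),
      frobHess A g x = ∑ k, fderiv ℝ (fderiv ℝ g) x (b k) (b k) := by
  obtain ⟨m, b, rfl⟩ := Matrix.posSemidef_iff_eq_sum_vecMulVec.1 hA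
  refine ⟨m, fun k => WithLp.toLp 2 (b k), fun g x => ?_⟩
  simp only [star_trivial, frobHess_sum, frobHess_vecMulVec]

theorem generator_nonpos_of_isLocalMax {A : Matrix (Fin n) (Fin n) ℝ} (hA : A.PosSemidef)
    (μ : Vec n) {g : Vec n → ℝ} (hg : ContDiff ℝ 2 g) {x : Vec n} (hx : IsLocalMax g x) :
    generator A μ g x ≤ 0 := by
  obtain ⟨m, B, hB⟩ := frobHess_eq_sum_fderiv_self hA
  have h : frobHess A g x ≤ 0 := by
    rw [hB]
    exact Finset.sum_nonpos fun k _ => fderiv_fderiv_self_nonpos_of_isLocalMax hg hx _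
  simp only [generator, hx.fderiv_eq_zero, _root_.zero_apply, smul_eq_mul]
  linarith

theorem frobHess_add {A : Matrix (Fin n) (Fin n) ℝ} {g h : Vec n → ℝ}
    (hg : ContDiff ℝ 2 g) (hh : ContDiff ℝ 2 h) (x : Vec n) :
    frobHess A (fun u => g u + h u) x = frobHess A g x + frobHess A h x := by
  have := fun_iteratedFDeriv_add_apply (i := 2) (x := x) hg.contDiffAt hh.contDiffAt
  simp [frobHess, this, mul_add, Finset.sum_add_distrib]

theorem frobHess_const_mul {A : Matrix (Fin n) (Fin n) ℝ} {g : Vec n → ℝ}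
    (hg : ContDiff ℝ 2 g) (c : ℝ) (x : Vec n) :
    frobHess A (fun u => c * g u) x = c * frobHess A g x := by
  have := iteratedFDeriv_const_smul_apply' (i := 2) (x := x) (a := c) hg.contDiffAt
  simp only [smul_eq_mul] at this
  simp only [frobHess, this, Finset.mul_sum, _root_.smul_eq_mul]
  refine Finset.sum_congr rfl fun i _ => Finset.sum_congr rfl fun j _ => ?_
  simp
  ring

theorem generator_linear_combination {A : Matrix (Fin n) (Fin n) ℝ} {g h : Vec n → ℝ}
    (hg : ContDiff ℝ 2 g) (hh : ContDiff ℝ 2 h) (c d : ℝ) (μ x : Vec n) :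
    generator A μ (fun u => c * g u + d * h u) x
      = c * generator A μ g x + d * generator A μ h x := by
  have hg' := hg.differentiable (by norm_num) x
  have hh' := hh.differentiable (by norm_num) x
  have h1 : fderiv ℝ (fun u => c * g u + d * h u) x = c • fderiv ℝ g x + d • fderiv ℝ h x := by
    rw [fderiv_fun_add (hg'.const_mul c) (hh'.const_mul d), fderiv_const_mul hg',
      fderiv_const_mul hh']
  simp only [generator, h1, frobHess_add (contDiff_const.mul hg) (contDiff_const.mul hh),
    frobHess_const_mul hg, frobHess_const_mul hh]
  simp
  ring

end Generator

/-! ### Lyapunov function -/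

section Lyapunov

variable {n : ℕ}

/-- The Lyapunov function `(1 + ‖x‖²) ^ k`. -/
noncomputable def lyapunov (n k : ℕ) (x : Vec n) : ℝ := (1 + ‖x‖ ^ 2) ^ k

theorem contDiff_lyapunov (k : ℕ) {r : WithTop ℕ∞} : ContDiff ℝ r (lyapunov n k) := by
  unfold lyapunov
  exact (contDiff_const.add (contDiff_norm_sq ℝ)).pow k

theorem hasDerivAt_one_add_norm_sq_line (x y : Vec n) (s : ℝ) :
    HasDerivAt (fun r : ℝ => 1 + ‖x + r • y‖ ^ 2) (2 * inner ℝ (x + s • y) y) s := by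
  have h1 : HasDerivAt (fun r : ℝ => x + r • y) y s := by
    simpa using ((hasDerivAt_id s).smul_const y).const_add x
  exact h1.norm_sq.const_add 1

theorem fderiv_lyapunov (k : ℕ) (x y : Vec n) :
    fderiv ℝ (lyapunov n k) x y = k * (1 + ‖x‖ ^ 2) ^ (k - 1) * (2 * inner ℝ x y) := by
  have h1 := (contDiff_lyapunov (n := n) k (r := 1)).hasDerivAt_comp_line x y 0
  have h2 := (hasDerivAt_one_add_norm_sq_line x y 0).pow k
  have h3 := h1.unique h2
  simpa using h3

theorem fderiv_fderiv_lyapunov (k : ℕ) (x y : Vec n) :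
    fderiv ℝ (fderiv ℝ (lyapunov n k)) x y y
      = k * ((k - 1 : ℕ) * (1 + ‖x‖ ^ 2) ^ (k - 1 - 1) * (2 * inner ℝ x y)) * (2 * inner ℝ x y)
        + k * (1 + ‖x‖ ^ 2) ^ (k - 1) * (2 * ‖y‖ ^ 2) := by
  have hl : HasDerivAt (fun r : ℝ => x + r • y) y 0 := by
    simpa using ((hasDerivAt_id (0 : ℝ)).smul_const y).const_add x
  have h1 := ((contDiff_lyapunov (n := n) k).hasFDerivAt_fderiv_apply
    (x + (0 : ℝ) • y) y).comp_hasDerivAt 0 hl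
  have h2 := (((hasDerivAt_one_add_norm_sq_line x y 0).pow (k - 1)).const_mul (k : ℝ)).mul
    ((hl.inner ℝ (hasDerivAt_const (0 : ℝ) y)).const_mul 2)
  have h3 : ((fun u => fderiv ℝ (lyapunov n k) u y) ∘ fun r : ℝ => x + r • y)
      = fun r : ℝ => k * (1 + ‖x + r • y‖ ^ 2) ^ (k - 1) * (2 * inner ℝ (x + r • y) y) := by
    funext r
    simp [fderiv_lyapunov]
  rw [h3] at h1
  have h4 := h1.unique h2
  simpa using h4

theorem fderiv_fderiv_lyapunov_le (k : ℕ) (x y : Vec n) :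
    fderiv ℝ (fderiv ℝ (lyapunov n k)) x y y ≤ (4 * k ^ 2 + 2 * k) * ‖y‖ ^ 2 * lyapunov n k x := by
  rw [fderiv_fderiv_lyapunov]
  have hρ : (1 : ℝ) ≤ 1 + ‖x‖ ^ 2 := by nlinarith [sq_nonneg ‖x‖]
  have hxy : (inner ℝ x y : ℝ) ^ 2 ≤ (1 + ‖x‖ ^ 2) * ‖y‖ ^ 2 := by
    have := abs_real_inner_le_norm x y
    have h := pow_le_pow_left₀ (abs_nonneg _) this 2
    rw [sq_abs] at h
    nlinarith [sq_nonneg ‖y‖]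
  -- The exponents `k - 1` and `k - 1 - 1` are truncated subtractions, so `k = 0` and `k = 1` are
  -- treated apart.
  rcases k with _ | _ | k
  · simp [lyapunov]
  · simp only [lyapunov]
    norm_num
    nlinarith [mul_nonneg (sq_nonneg ‖x‖) (sq_nonneg ‖y‖), sq_nonneg ‖y‖]
  · simp only [lyapunov, Nat.add_sub_cancel]
    push_cast
    set ρ := 1 + ‖x‖ ^ 2
    have hρk : (0 : ℝ) ≤ ρ ^ k := by positivity
    have e1 : ((k : ℝ) + 1 + 1) * ((k + 1) * ρ ^ k * (2 * inner ℝ x y)) * (2 * inner ℝ x y)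
        ≤ 4 * (k + 1 + 1) ^ 2 * (ρ ^ k * (ρ ^ 2 * ‖y‖ ^ 2)) := by
      have a1 : ρ ^ k * (inner ℝ x y : ℝ) ^ 2 ≤ ρ ^ k * (ρ ^ 2 * ‖y‖ ^ 2) := by
        refine mul_le_mul_of_nonneg_left (hxy.trans ?_) hρk
        exact mul_le_mul_of_nonneg_right (by nlinarith) (sq_nonneg _)
      have a2 : (0 : ℝ) ≤ ρ ^ k * (ρ ^ 2 * ‖y‖ ^ 2) := by positivity
      calc _ = 4 * (((k : ℝ) + 1 + 1) * (k + 1)) * (ρ ^ k * (inner ℝ x y : ℝ) ^ 2) := by ring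
        _ ≤ 4 * (((k : ℝ) + 1 + 1) * (k + 1)) * (ρ ^ k * (ρ ^ 2 * ‖y‖ ^ 2)) := by gcongr
        _ ≤ _ := by
          refine mul_le_mul_of_nonneg_right ?_ a2
          nlinarith [(Nat.cast_nonneg k : (0 : ℝ) ≤ k)]
    have e2 : ((k : ℝ) + 1 + 1) * ρ ^ (k + 1) * (2 * ‖y‖ ^ 2)
        ≤ 2 * (k + 1 + 1) * (ρ ^ k * (ρ ^ 2 * ‖y‖ ^ 2)) := by
      have a1 : ρ ^ (k + 1) ≤ ρ ^ (k + 2) := pow_le_pow_right₀ hρ (by omega)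
      calc _ = 2 * ((k : ℝ) + 1 + 1) * (ρ ^ (k + 1) * ‖y‖ ^ 2) := by ring
        _ ≤ 2 * ((k : ℝ) + 1 + 1) * (ρ ^ (k + 2) * ‖y‖ ^ 2) := by gcongr
        _ = _ := by ring
    calc _ ≤ _ := add_le_add e1 e2
      _ = _ := by ring

/-- The gradient of the Lyapunov function is a nonnegative multiple of `x`, so only an upper bound
on `x · μ` is needed, and `C` does not depend on the drift. -/
theorem exists_generator_lyapunov_le {A : Matrix (Fin n) (Fin n) ℝ} (hA : A.PosSemidef)
    (K : ℝ) (k : ℕ) : ∃ C : ℝ, ∀ x μ : Vec n, inner ℝ x μ ≤ K * (1 + ‖x‖ ^ 2) →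
      generator A μ (lyapunov n k) x ≤ C * lyapunov n k x := by
  obtain ⟨m, B, hB⟩ := frobHess_eq_sum_fderiv_self hA
  refine ⟨2 * k * K + 1 / 2 * ∑ i, (4 * k ^ 2 + 2 * k) * ‖B i‖ ^ 2,
    fun x μ hμ => ?_⟩
  have h1 : fderiv ℝ (lyapunov n k) x μ ≤ 2 * k * K * lyapunov n k x := by
    rw [fderiv_lyapunov]
    rcases k with _ | k
    · simp
    · simp only [lyapunov, Nat.add_sub_cancel]
      calc ((k + 1 : ℕ) : ℝ) * (1 + ‖x‖ ^ 2) ^ k * (2 * inner ℝ x μ)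
          ≤ ((k + 1 : ℕ) : ℝ) * (1 + ‖x‖ ^ 2) ^ k * (2 * (K * (1 + ‖x‖ ^ 2))) := by gcongr
        _ = _ := by ring
  have h2 : frobHess A (lyapunov n k) x
      ≤ (∑ i, (4 * k ^ 2 + 2 * k) * ‖B i‖ ^ 2) * lyapunov n k x := by
    rw [hB, Finset.sum_mul]
    exact Finset.sum_le_sum fun i _ => fderiv_fderiv_lyapunov_le k x _
  simp only [generator, smul_eq_mul]
  linarith

end Lyapunov

/-! ### Maximum principle with doubled variables -/

section MaximumPrinciple

theorem HasDerivAt.nonpos_of_isMaxOn_Icc {f : ℝ → ℝ} {f' a b : ℝ} (hab : a < b)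
    (hf : HasDerivAt f f' a) (hmax : IsMaxOn f (Icc a b) a) : f' ≤ 0 := by
  have hcone : b - a ∈ posTangentConeAt (Icc a b) a :=
    sub_mem_posTangentConeAt_of_segment_subset (by rw [segment_eq_Icc hab.le])
  have h := (hmax.localize).hasFDerivWithinAt_nonpos hf.hasFDerivAt.hasFDerivWithinAt hcone
  simp only [ContinuousLinearMap.toSpanSingleton_apply, smul_eq_mul] at h
  nlinarith [sub_pos.2 hab]

theorem abs_sub_le_of_norm_gradient_le {n : ℕ} {g : Vec n → ℝ} (hg : Differentiable ℝ g)
    {K : ℝ} {m : ℕ} (hgrow : ∀ x, ‖gradient g x‖ ≤ K * (1 + ‖x‖) ^ m) (x : Vec n) :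
    |g x - g 0| ≤ K * (1 + ‖x‖) ^ (m + 1) := by
  have hK : 0 ≤ K := by simpa using (norm_nonneg _).trans (hgrow 0)
  have h : ‖g x - g 0‖ ≤ K * (1 + ‖x‖) ^ m * ‖x - 0‖ := by
    refine (convex_closedBall (0 : Vec n) ‖x‖).norm_image_sub_le_of_norm_fderiv_le (𝕜 := ℝ)
      (fun y _ => hg y) (fun y hy => ?_) (by simp) (by simp)
    rw [← toDual_gradient, LinearIsometryEquiv.norm_map]
    refine (hgrow y).trans ?_
    have : ‖y‖ ≤ ‖x‖ := by simpa using hy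
    gcongr
  rw [sub_zero, Real.norm_eq_abs] at h
  refine h.trans ?_
  rw [pow_succ, mul_assoc]
  gcongr
  linarith

theorem one_add_norm_pow_sq_le_lyapunov {n : ℕ} (k : ℕ) (x : Vec n) :
    ((1 + ‖x‖) ^ k) ^ 2 ≤ 2 ^ k * lyapunov n k x := by
  rw [lyapunov, ← mul_pow, ← pow_mul, mul_comm k 2, pow_mul]
  refine pow_le_pow_left₀ (by positivity) ?_ k
  nlinarith [sq_nonneg (1 - ‖x‖)]

/-- A polynomially growing function of two points is dominated by the sum of the Lyapunov functions
outside a ball. -/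
theorem exists_radius_lyapunov {n : ℕ} {K ε : ℝ} (hK : 0 ≤ K) (hε : 0 < ε) (m : ℕ) :
    ∃ r : ℝ, ∀ x y : Vec n,
      0 < K * (1 + ‖x‖) ^ (m + 1) + K * (1 + ‖y‖) ^ (m + 1)
        - ε * (lyapunov n (m + 1) x + lyapunov n (m + 1) y) → ‖x‖ ≤ r ∧ ‖y‖ ≤ r := by
  -- If `a > 2K/δ`, then `Ka - δa² < -Ka`, so positivity forces `Kb - δb² > Ka ≥ 0` and thus `δb <
  -- K`. Then `δKb ≤ K²` while `δKa ≥ 2K²`, a contradiction.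
  have key : ∀ a b δ : ℝ, 0 < δ → 0 < a → 0 < b →
      0 < K * a + K * b - δ * (a ^ 2 + b ^ 2) → a ≤ 2 * K / δ := by
    intro a b δ hδ ha hb h
    by_contra! hlt
    rw [div_lt_iff₀ hδ] at hlt
    have h2 : 0 < K * b - δ * b ^ 2 - K * a := by nlinarith
    have h3 : δ * b < K := by
      by_contra! h4
      nlinarith [mul_nonneg hK ha.le]
    have h5 : δ * (K * b - δ * b ^ 2 - K * a) ≤ 0 := by
      nlinarith [mul_nonneg hK hK, mul_le_mul_of_nonneg_left hlt.le hK,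
        mul_le_mul_of_nonneg_left h3.le hK, mul_pos hδ (pow_pos hb 2)]
    nlinarith
  refine ⟨2 * K / (ε / 2 ^ (m + 1)), fun x y h => ?_⟩
  have hone : ∀ z : Vec n, ‖z‖ ≤ (1 + ‖z‖) ^ (m + 1) := fun z =>
    calc ‖z‖ ≤ 1 + ‖z‖ := by linarith
      _ ≤ _ := le_self_pow₀ (by linarith [norm_nonneg z]) (by omega)
  have hlow : ∀ z : Vec n, ε / 2 ^ (m + 1) * ((1 + ‖z‖) ^ (m + 1)) ^ 2
      ≤ ε * lyapunov n (m + 1) z := fun z => by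
    rw [div_mul_eq_mul_div, div_le_iff₀ (by positivity)]
    nlinarith [mul_le_mul_of_nonneg_left (one_add_norm_pow_sq_le_lyapunov (m + 1) z) hε.le]
  have hδ : 0 < ε / 2 ^ (m + 1) := by positivity
  have hx := hlow x
  have hy := hlow y
  exact ⟨(hone x).trans (key _ ((1 + ‖y‖) ^ (m + 1)) _ hδ (by positivity) (by positivity)
      (by nlinarith)),
    (hone y).trans (key _ ((1 + ‖x‖) ^ (m + 1)) _ hδ (by positivity) (by positivity)
      (by nlinarith))⟩

/-- Uniqueness up to a function of time for a linear backward parabolic equation, in the class of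
functions with polynomially growing gradient: the equation, the continuity and the terminal
condition are only imposed on the differences `w t x - w t y`. -/
theorem eq_of_backward_parabolic {n : ℕ} {A : Matrix (Fin n) (Fin n) ℝ} (hA : A.PosSemidef)
    {T : ℝ} {w : ℝ → Vec n → ℝ} {μ : ℝ → Vec n → Vec n} {K : ℝ} {m : ℕ}
    (hcont : ContinuousOn (fun z : ℝ × Vec n × Vec n => w z.1 z.2.1 - w z.1 z.2.2)
      (Icc 0 T ×ˢ univ))
    (hC2 : ∀ t ∈ Ioo 0 T, ContDiff ℝ 2 (w t))
    (hgrow : ∀ t ∈ Ioo 0 T, ∀ x, ‖gradient (w t) x‖ ≤ K * (1 + ‖x‖) ^ m)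
    (hdrift : ∀ t ∈ Ioo 0 T, ∀ x, inner ℝ x (μ t x) ≤ K * (1 + ‖x‖ ^ 2))
    (hderiv : ∀ t ∈ Ioo 0 T, ∀ x y, HasDerivAt (fun s => w s x - w s y)
      (generator A (μ t y) (w t) y - generator A (μ t x) (w t) x) t)
    (hterm : ∀ x y, w T x = w T y) {t : ℝ} (ht : t ∈ Ioo 0 T) (x y : Vec n) :
    w t x ≤ w t y := by
  obtain ⟨C, hC⟩ := exists_generator_lyapunov_le hA K (m + 1)
  set V := lyapunov n (m + 1) with hV
  have hVpos : ∀ z, 0 < V z := fun z => by simp only [hV, lyapunov]; positivity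
  have hK : 0 ≤ K := by simpa using (norm_nonneg _).trans (hgrow t ht 0)
  by_contra! hlt
  set l := C + 1 with hl
  -- The rate must exceed `C`; the absolute value also gives `E ≥ 1` up to time `T`, so that the
  -- weight never weakens the penalty.
  set E : ℝ → ℝ := fun s => Real.exp (|l| * (T - s)) with hE
  have hEpos : ∀ s, 0 < E s := fun s => Real.exp_pos _
  obtain ⟨ε, hε, hεlt⟩ : ∃ ε > 0, ε * (E t * (V x + V y)) < w t x - w t y := by
    have h1 : 0 < E t * (V x + V y) := mul_pos (hEpos t) (add_pos (hVpos x) (hVpos y))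
    refine ⟨(w t x - w t y) / (2 * (E t * (V x + V y))), div_pos (by linarith) (by linarith), ?_⟩
    rw [div_mul_eq_mul_div, div_lt_iff₀ (by linarith)]
    nlinarith
  set z : ℝ × Vec n × Vec n → ℝ := fun p =>
    w p.1 p.2.1 - w p.1 p.2.2 - ε * (E p.1 * (V p.2.1 + V p.2.2)) with hz
  obtain ⟨r, hr⟩ := exists_radius_lyapunov (n := n) hK hε m
  -- Where `z` is positive, time is below `T` because `w T` is constant, and both points lie in a
  -- fixed ball because the penalty has twice the degree of the bound on `w`. So the maximum over
  -- the compact set is global.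
  have hbound : ∀ s ∈ Icc t T, ∀ a b : Vec n, 0 < z (s, a, b) → s < T ∧ ‖a‖ ≤ r ∧ ‖b‖ ≤ r := by
    intro s hs a b hpos
    have hVV : 0 < V a + V b := add_pos (hVpos a) (hVpos b)
    have hsT : s < T := by
      refine lt_of_le_of_ne hs.2 ?_
      rintro rfl
      simp only [hz, hterm a b] at hpos
      nlinarith [mul_pos hε (mul_pos (hEpos s) hVV)]
    refine ⟨hsT, hr a b (hpos.trans_le ?_)⟩
    have hs' : s ∈ Ioo 0 T := ⟨ht.1.trans_le hs.1, hsT⟩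
    have hdiff := (hC2 s hs').differentiable (by norm_num)
    have ha := (abs_le.1 (abs_sub_le_of_norm_gradient_le hdiff (hgrow s hs') a)).2
    have hb := (abs_le.1 (abs_sub_le_of_norm_gradient_le hdiff (hgrow s hs') b)).1
    have hE1 : 1 ≤ E s := Real.one_le_exp (mul_nonneg (abs_nonneg l) (by linarith [hs.2]))
    have : V a + V b ≤ E s * (V a + V b) := le_mul_of_one_le_left hVV.le hE1
    have := mul_le_mul_of_nonneg_left this hε.le
    simp only [hz]
    linarith
  have hVcont : Continuous V := (contDiff_lyapunov (m + 1) (r := 0)).continuous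
  have hzcont : ContinuousOn z (Icc 0 T ×ˢ univ) := by
    refine hcont.sub (Continuous.continuousOn ?_)
    simp only [hE]
    fun_prop
  have hpos : 0 < z (t, x, y) := by simp only [hz]; linarith
  obtain ⟨-, hxr, hyr⟩ := hbound t ⟨le_rfl, ht.2.le⟩ x y hpos
  obtain ⟨⟨s, a, b⟩, ⟨hs, -⟩, hmax⟩ := (isCompact_Icc.prod ((isCompact_closedBall (0 : Vec n)
      r).prod (isCompact_closedBall (0 : Vec n) r))).exists_isMaxOn (f := z)
    ⟨(t, x, y), ⟨le_rfl, ht.2.le⟩, by simpa using hxr, by simpa using hyr⟩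
    (hzcont.mono (prod_mono (Icc_subset_Icc_left ht.1.le) (subset_univ _)))
  have hmaxpos : 0 < z (s, a, b) :=
    hpos.trans_le (hmax ⟨⟨le_rfl, ht.2.le⟩, by simpa using hxr, by simpa using hyr⟩)
  have hglobal : ∀ s' ∈ Icc t T, ∀ a' b', z (s', a', b') ≤ z (s, a, b) := by
    intro s' hs' a' b'
    by_contra! h
    obtain ⟨-, h1, h2⟩ := hbound s' hs' a' b' (hmaxpos.trans h)
    exact absurd (hmax (show (s', a', b') ∈ _ from ⟨hs', by simpa using h1, by simpa using h2⟩))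
      (not_le.2 h)
  have hsT := (hbound s hs a b hmaxpos).1
  have hs' : s ∈ Ioo 0 T := ⟨ht.1.trans_le hs.1, hsT⟩
  have hVC2 : ContDiff ℝ 2 V := contDiff_lyapunov (m + 1)
  -- The variables `a` and `b` are not coupled in `z`, so the second-order test applies to each
  -- separately.
  have ha : generator A (μ s a) (w s) a ≤ ε * E s * generator A (μ s a) V a := by
    have h := generator_nonpos_of_isLocalMax hA (μ s a) (x := a)
      (g := fun u => 1 * w s u + (-(ε * E s)) * V u)
      ((contDiff_const.mul (hC2 s hs')).add (contDiff_const.mul hVC2))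
      (Filter.Eventually.of_forall fun u => by
        have := hglobal s hs u b
        simp only [hz] at this
        linarith)
    rw [generator_linear_combination (hC2 s hs') hVC2] at h
    linarith
  have hb : -generator A (μ s b) (w s) b ≤ ε * E s * generator A (μ s b) V b := by
    have h := generator_nonpos_of_isLocalMax hA (μ s b) (x := b)
      (g := fun u => (-1) * w s u + (-(ε * E s)) * V u)
      ((contDiff_const.mul (hC2 s hs')).add (contDiff_const.mul hVC2))
      (Filter.Eventually.of_forall fun u => by
        have := hglobal s hs a u
        simp only [hz] at this
        linarith)
    rw [generator_linear_combination (hC2 s hs') hVC2] at h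
    linarith
  -- The maximum may sit at the initial time `t`, so only the forward derivative is used. Combined
  -- with `ha` and `hb`, it gives `|l| εE(V a + V b) ≤ C εE(V a + V b)`, contrary to `|l| ≥ C + 1`.
  have htime := HasDerivAt.nonpos_of_isMaxOn_Icc hsT (f := fun s' => z (s', a, b))
    (f' := generator A (μ s b) (w s) b - generator A (μ s a) (w s) a
      - ε * (E s * (|l| * -1) * (V a + V b)))
    ((hderiv s hs' a b).sub
      ((((((hasDerivAt_id s).const_sub T).const_mul |l|).exp).mul_const (V a + V b)).const_mul ε))
    (fun s' hs'' => hglobal s' ⟨hs.1.trans hs''.1, hs''.2⟩ a b)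
  have hεE : 0 < ε * E s := mul_pos hε (hEpos s)
  have hCa := mul_le_mul_of_nonneg_left (hC a (μ s a) (hdrift s hs' a)) hεE.le
  have hCb := mul_le_mul_of_nonneg_left (hC b (μ s b) (hdrift s hs' b)) hεE.le
  have hlC : C + 1 ≤ |l| := le_abs_self l
  have hfin : (C + 1) * (ε * E s * (V a + V b)) ≤ |l| * (ε * E s * (V a + V b)) :=
    mul_le_mul_of_nonneg_right hlC (mul_pos hεE (add_pos (hVpos a) (hVpos b))).le
  have : 0 < ε * E s * (V a + V b) := mul_pos hεE (add_pos (hVpos a) (hVpos b))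
  nlinarith

end MaximumPrinciple

/-! ### From derivatives along a curve to derivatives at a fixed point -/

section Transport

variable {E : Type*} [NormedAddCommGroup E] [NormedSpace ℝ E]

/-- If `g s (X s)` is differentiable in time along a curve `X` then `g s (X t)` is differentiable
in time at `t`, provided that `g` is differentiable in space with jointly continuous derivative. -/
theorem hasDerivAt_of_hasDerivAt_along {g : ℝ → E → ℝ} {X : ℝ → E} {X' : E} {p t : ℝ}
    (hX : HasDerivAt X X' t) (hp : HasDerivAt (fun s => g s (X s)) p t)
    (hdiff : ∀ᶠ s in nhds t, Differentiable ℝ (g s))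
    (hcont : ContinuousAt (fun z : ℝ × E => fderiv ℝ (g z.1) z.2) (t, X t)) :
    HasDerivAt (fun s => g s (X t)) (p - fderiv ℝ (g t) (X t) X') t := by
  set A := fderiv ℝ (g t) (X t) with hA
  -- The mean value inequality on a small ball gives this uniformly in `s`, thanks to joint
  -- continuity of the spatial derivative.
  have hrem : (fun s => g s (X s) - g s (X t) - A (X s - X t)) =o[nhds t] fun s => X s - X t := by
    rw [Asymptotics.isLittleO_iff]
    intro ε hε
    have h1 : ∀ᶠ z in nhds (t, X t), ‖fderiv ℝ (g z.1) z.2 - A‖ ≤ ε := by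
      have := Metric.continuousAt_iff'.1 hcont ε hε
      filter_upwards [this] with z hz
      rw [← dist_eq_norm]
      exact hz.le
    rw [nhds_prod_eq] at h1
    obtain ⟨u, hu, v, hv, huv⟩ := Filter.eventually_prod_iff.1 h1
    obtain ⟨δ, hδ, hball⟩ := Metric.eventually_nhds_iff_ball.1 hv
    have hXball := hX.continuousAt.eventually (Metric.ball_mem_nhds (X t) hδ)
    filter_upwards [hu, hdiff, hXball] with s hs hds hXs
    exact (convex_ball (X t) δ).norm_image_sub_le_of_norm_fderiv_le' (𝕜 := ℝ)
      (fun y _ => hds y) (fun y hy => huv hs (hball y hy)) (Metric.mem_ball_self hδ) hXs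
  have hrem' : HasDerivAt (fun s => g s (X s) - g s (X t) - A (X s - X t)) 0 t := by
    rw [hasDerivAt_iff_isLittleO]
    simpa using hrem.trans_isBigO hX.isBigO_sub
  have hlin : HasDerivAt (fun s => A (X s - X t)) (A X') t :=
    A.hasFDerivAt.comp_hasDerivAt t (hX.sub_const (X t))
  have := (hp.sub hrem').sub hlin
  simp only [sub_zero] at this
  refine this.congr_of_eventuallyEq (Filter.Eventually.of_forall fun s => ?_)
  simp only [Pi.sub_apply]
  ring

end Transport

/-! ### Third derivatives -/

section ThirdOrder

variable {n : ℕ}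

theorem ContDiff.hasFDerivAt_fderiv_fderiv_apply {g : Vec n → ℝ} (hg : ContDiff ℝ 3 g)
    (x y z : Vec n) :
    HasFDerivAt (fun u => fderiv ℝ (fderiv ℝ g) u y z)
      (fderiv ℝ (fun u => fderiv ℝ (fderiv ℝ g) u y z) x) x := by
  have h1 : ContDiff ℝ 2 (fderiv ℝ g) := hg.fderiv_right (by norm_num)
  have h2 : ContDiff ℝ 1 (fderiv ℝ (fderiv ℝ g)) := h1.fderiv_right (by norm_num)
  have h3 : ContDiff ℝ 1 (fun u => fderiv ℝ (fderiv ℝ g) u y z) :=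
    (h2.clm_apply contDiff_const).clm_apply contDiff_const
  exact (h3.differentiable (by norm_num) x).hasFDerivAt

theorem ContDiff.contDiff_fderiv_apply_const {g : Vec n → ℝ} (hg : ContDiff ℝ 3 g) (y : Vec n) :
    ContDiff ℝ 2 (fun u => fderiv ℝ g u y) :=
  (hg.fderiv_right (m := 2) (by norm_num)).clm_apply contDiff_const

/-- The second derivatives of a directional derivative are the directional derivatives of the
second derivatives. -/
theorem ContDiff.fderiv_fderiv_fderiv_comm {g : Vec n → ℝ} (hg : ContDiff ℝ 3 g)
    (x a b y : Vec n) :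
    fderiv ℝ (fderiv ℝ (fun u => fderiv ℝ g u y)) x a b
      = fderiv ℝ (fun u => fderiv ℝ (fderiv ℝ g) u a b) x y := by
  have hdir : ∀ (c d u : Vec n), fderiv ℝ (fun u => fderiv ℝ g u c) u d
      = fderiv ℝ (fderiv ℝ g) u d c := fun c d u => by
    rw [((hg.of_le (by norm_num)).hasFDerivAt_fderiv_apply u c).fderiv]
    simp
  have hswap : (fun u => fderiv ℝ (fun u => fderiv ℝ g u y) u b)
      = fun u => fderiv ℝ (fun u => fderiv ℝ g u b) u y := by
    funext u
    rw [hdir, hdir, (hg.of_le (by norm_num)).fderiv_fderiv_comm]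
  have e1 : fderiv ℝ (fderiv ℝ (fun u => fderiv ℝ g u y)) x a b
      = fderiv ℝ (fun u => fderiv ℝ (fun u => fderiv ℝ g u y) u b) x a := by
    rw [((hg.contDiff_fderiv_apply_const y).hasFDerivAt_fderiv_apply x b).fderiv]
    simp
  have e2 : fderiv ℝ (fun u => fderiv ℝ (fun u => fderiv ℝ g u b) u y) x a
      = fderiv ℝ (fun u => fderiv ℝ (fun u => fderiv ℝ g u b) u a) x y := by
    rw [((hg.contDiff_fderiv_apply_const b).hasFDerivAt_fderiv_apply x y).fderiv,
      ((hg.contDiff_fderiv_apply_const b).hasFDerivAt_fderiv_apply x a).fderiv]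
    simp only [ContinuousLinearMap.flip_apply]
    exact (hg.contDiff_fderiv_apply_const b).fderiv_fderiv_comm x a y
  rw [e1, hswap, e2]
  simp_rw [hdir]

theorem ContDiff.frobHess_fderiv_apply {g : Vec n → ℝ} (hg : ContDiff ℝ 3 g)
    (A : Matrix (Fin n) (Fin n) ℝ) (x y : Vec n) :
    frobHess A (fun u => fderiv ℝ g u y) x = fderiv ℝ (frobHess A g) x y := by
  have h : HasFDerivAt (frobHess A g) (∑ i, ∑ j, A i j • fderiv ℝ
      (fun u => fderiv ℝ (fderiv ℝ g) u (EuclideanSpace.single i (1 : ℝ))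
        (EuclideanSpace.single j (1 : ℝ))) x) x := by
    have := HasFDerivAt.fun_sum (u := Finset.univ) fun i _ =>
      HasFDerivAt.fun_sum (u := Finset.univ) fun j _ =>
        (hg.hasFDerivAt_fderiv_fderiv_apply x (EuclideanSpace.single i (1 : ℝ))
          (EuclideanSpace.single j (1 : ℝ))).const_smul (A i j)
    refine this.congr_of_eventuallyEq (Filter.Eventually.of_forall fun u => ?_)
    exact frobHess_eq_sum_fderiv A g u
  rw [h.fderiv, frobHess_eq_sum_fderiv]
  simp [hg.fderiv_fderiv_fderiv_comm]

theorem ContDiff.differentiable_frobHess {g : Vec n → ℝ} (hg : ContDiff ℝ 3 g)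
    (A : Matrix (Fin n) (Fin n) ℝ) : Differentiable ℝ (frobHess A g) := by
  have : frobHess A g = fun x => ∑ i, ∑ j, A i j • fderiv ℝ (fderiv ℝ g) x
      (EuclideanSpace.single i (1 : ℝ)) (EuclideanSpace.single j (1 : ℝ)) :=
    funext (frobHess_eq_sum_fderiv A g)
  rw [this]
  refine Differentiable.fun_sum fun i _ => Differentiable.fun_sum fun j _ => ?_
  exact fun x => (hg.hasFDerivAt_fderiv_fderiv_apply x _ _).differentiableAt.fun_const_smul _

/-- Transfers the assumed joint continuity of the third derivative to the gradient of the diffusion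
term. -/
theorem ContDiff.fderiv_frobHess_eq_sum {g : Vec n → ℝ} (hg : ContDiff ℝ 3 g)
    (A : Matrix (Fin n) (Fin n) ℝ) (x y : Vec n) :
    fderiv ℝ (frobHess A g) x y = ∑ i, ∑ j, A i j * iteratedFDeriv ℝ 3 g x
      ![EuclideanSpace.single i (1 : ℝ), EuclideanSpace.single j (1 : ℝ), y] := by
  rw [← hg.frobHess_fderiv_apply, frobHess]
  refine Finset.sum_congr rfl fun i _ => Finset.sum_congr rfl fun j _ => ?_
  rw [smul_eq_mul]
  congr 1
  have h1 := (ContinuousLinearMap.apply ℝ ℝ y).iteratedFDeriv_comp_left (i := 2) (x := x)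
    (hg.fderiv_right (m := 2) (by norm_num)).contDiffAt le_rfl
  have h2 : (fun u => fderiv ℝ g u y) = ContinuousLinearMap.apply ℝ ℝ y ∘ fderiv ℝ g := rfl
  rw [h2, h1, iteratedFDeriv_succ_apply_right]
  simp only [ContinuousLinearMap.compContinuousMultilinearMap_coe, Function.comp_apply,
    ContinuousLinearMap.apply_apply]
  congr 2
  ext k
  fin_cases k <;> rfl

end ThirdOrder

/-! ### Derivatives of the gradient field -/

section Gradient

variable {n : ℕ}

theorem ContDiff.contDiff_gradient {g : Vec n → ℝ} {k l : WithTop ℕ∞} (hg : ContDiff ℝ l g)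
    (hk : k + 1 ≤ l) : ContDiff ℝ k (gradient g) := by
  rw [contDiff_euclidean]
  intro i
  have : (fun x => (gradient g x) i)
      = fun x => fderiv ℝ g x (EuclideanSpace.single i (1 : ℝ)) := by
    funext x
    rw [← inner_gradient_left, EuclideanSpace.inner_single_right]
    simp
  rw [this]
  exact (hg.fderiv_right hk).clm_apply contDiff_const

theorem inner_fderiv_gradient {g : Vec n → ℝ} (hg : ContDiff ℝ 2 g) (x y z : Vec n) :
    inner ℝ (fderiv ℝ (gradient g) x y) z = fderiv ℝ (fderiv ℝ g) x y z := by
  have h1 := ((hg.contDiff_gradient (k := 1) (by norm_num)).differentiable (by norm_num)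
    x).hasFDerivAt.inner ℝ (hasFDerivAt_const z x)
  simp only [inner_gradient_left] at h1
  have h2 := hg.hasFDerivAt_fderiv_apply x z
  have := congrArg (fun L => L y) (h1.unique h2)
  simpa using this

theorem inner_frobHess_gradient {g : Vec n → ℝ} (hg : ContDiff ℝ 3 g)
    (A : Matrix (Fin n) (Fin n) ℝ) (x y : Vec n) :
    inner ℝ (frobHess A (gradient g) x) y = fderiv ℝ (frobHess A g) x y := by
  rw [← hg.frobHess_fderiv_apply]
  have h1 : ∀ m, iteratedFDeriv ℝ 2 (fun u => fderiv ℝ g u y) x m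
      = inner ℝ (iteratedFDeriv ℝ 2 (gradient g) x m) y := by
    intro m
    have h2 : (fun u => fderiv ℝ g u y) = innerSL ℝ y ∘ gradient g := by
      funext u
      rw [← inner_gradient_left, real_inner_comm]
      rfl
    rw [h2, (innerSL ℝ y).iteratedFDeriv_comp_left (i := 2)
      (hg.contDiff_gradient (k := 2) (by norm_num)).contDiffAt le_rfl]
    simp [real_inner_comm]
  simp only [frobHess, h1, sum_inner, inner_smul_left]
  simp

end Gradient

/-! ### Integration along segments -/

section Segment

open MeasureTheory

theorem hasDerivAt_intervalIntegral_of_continuousOn {a b : ℝ} {f f' : ℝ → ℝ → ℝ}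
    (hf : ∀ t ∈ Ioo a b, Continuous (f t))
    (hf' : ContinuousOn (fun z : ℝ × ℝ => f' z.1 z.2) (Ioo a b ×ˢ univ))
    (hderiv : ∀ t ∈ Ioo a b, ∀ s, HasDerivAt (fun r => f r s) (f' t s) t) {t : ℝ}
    (ht : t ∈ Ioo a b) :
    HasDerivAt (fun r => ∫ s in (0 : ℝ)..1, f r s) (∫ s in (0 : ℝ)..1, f' t s) t := by
  obtain ⟨δ, hδ, hball⟩ := Metric.nhds_basis_closedBall.mem_iff.1 (isOpen_Ioo.mem_nhds ht)
  obtain ⟨C, hC⟩ := ((isCompact_closedBall t δ).prod (isCompact_Icc (a := (0 : ℝ))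
    (b := 1))).exists_bound_of_continuousOn (hf'.mono (prod_mono hball (subset_univ _)))
  have hslice : Continuous (f' t) := by
    refine (hf'.comp_continuous (f := fun s : ℝ => (t, s)) (by fun_prop) fun s => ⟨ht, mem_univ _⟩)
  refine (intervalIntegral.hasDerivAt_integral_of_dominated_loc_of_deriv_le
    (F := f) (F' := f') (bound := fun _ => C)
    (Metric.closedBall_mem_nhds t hδ) ?_ ((hf t ht).intervalIntegrable _ _)
    hslice.aestronglyMeasurable ?_ intervalIntegrable_const ?_).2
  · filter_upwards [isOpen_Ioo.mem_nhds ht] with r hr using (hf r hr).aestronglyMeasurable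
  · refine Filter.Eventually.of_forall fun s hs r hr => hC (r, s) ⟨hr, ?_⟩
    rw [uIoc_of_le zero_le_one] at hs
    exact Ioc_subset_Icc_self hs
  · exact Filter.Eventually.of_forall fun s _ r hr => hderiv r (hball hr) s

theorem integral_fderiv_segment {E : Type*} [NormedAddCommGroup E] [NormedSpace ℝ E]
    {g : E → ℝ} (hg : Differentiable ℝ g) (x y : E)
    (hcont : Continuous fun u => fderiv ℝ g u (x - y)) :
    ∫ s in (0 : ℝ)..1, fderiv ℝ g (y + s • (x - y)) (x - y) = g x - g y := by
  have hline : ∀ s : ℝ, HasDerivAt (fun r : ℝ => g (y + r • (x - y)))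
      (fderiv ℝ g (y + s • (x - y)) (x - y)) s := fun s => by
    have h1 : HasDerivAt (fun r : ℝ => y + r • (x - y)) (x - y) s := by
      simpa using ((hasDerivAt_id s).smul_const (x - y)).const_add y
    exact (hg _).hasFDerivAt.comp_hasDerivAt s h1
  have hc : Continuous fun s : ℝ => fderiv ℝ g (y + s • (x - y)) (x - y) :=
    hcont.comp (f := fun s : ℝ => y + s • (x - y)) (by fun_prop)
  rw [intervalIntegral.integral_eq_sub_of_hasDerivAt (fun s _ => hline s)
    (hc.intervalIntegrable _ _)]
  simp

end Segment

/-! ### The HJB operator -/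

namespace ControlProblem

variable {dx du : ℕ} (S : ControlProblem dx du)

/-- The operator `p ↦ G(x) R G(x)ᵀ p`. -/
noncomputable def controlOperator (x : Vec dx) : Vec dx →L[ℝ] Vec dx :=
  Matrix.toEuclideanCLM (n := Fin dx) (𝕜 := ℝ) (S.G x * S.R * (S.G x)ᵀ)

theorem controlOperator_apply (x p : Vec dx) : S.controlOperator x p = S.GRGt x p := by
  ext i
  simp [controlOperator, GRGt, RGt, mulV, Matrix.mulVec_mulVec, Matrix.mul_assoc]

theorem R_transpose : S.Rᵀ = S.R := by
  simpa using S.posDef_R.isHermitian.eq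

theorem inner_controlOperator_comm (x p q : Vec dx) :
    inner ℝ (S.controlOperator x p) q = inner ℝ p (S.controlOperator x q) := by
  have hsymm : (S.G x * S.R * (S.G x)ᵀ)ᵀ = S.G x * S.R * (S.G x)ᵀ := by
    simp [Matrix.transpose_mul, R_transpose, Matrix.mul_assoc]
  have hp : (S.controlOperator x p).ofLp = (S.G x * S.R * (S.G x)ᵀ) *ᵥ p.ofLp := rfl
  have hq : (S.controlOperator x q).ofLp = (S.G x * S.R * (S.G x)ᵀ) *ᵥ q.ofLp := rfl
  simp only [EuclideanSpace.inner_eq_star_dotProduct, star_trivial, hp, hq]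
  rw [Matrix.dotProduct_mulVec, ← Matrix.mulVec_transpose, hsymm, dotProduct_comm]

/-- The `R⁻¹` of the norm cancels one `R`, leaving a quadratic form in `p` with a symmetric
operator. -/
theorem weightedNormSq_RGt (x p : Vec dx) :
    weightedNormSq S.R (S.RGt x p) = inner ℝ p (S.controlOperator x p) := by
  have hR : IsUnit S.R.det := (Matrix.isUnit_iff_isUnit_det _).1 S.posDef_R.isUnit
  have hp : (S.controlOperator x p).ofLp = (S.G x * S.R * (S.G x)ᵀ) *ᵥ p.ofLp := rfl
  simp only [EuclideanSpace.inner_eq_star_dotProduct, star_trivial, hp, weightedNormSq, RGt, mulV,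
    Matrix.mulVec_mulVec, ← Matrix.mul_assoc, Matrix.nonsing_inv_mul _ hR, Matrix.one_mul]
  rw [Matrix.dotProduct_mulVec, Matrix.vecMul_transpose, Matrix.mulVec_mulVec, ← Matrix.mul_assoc]

theorem contDiff_controlOperator : ContDiff ℝ 1 S.controlOperator := by
  rw [contDiff_clm_apply_iff]
  intro p
  rw [contDiff_euclidean]
  intro i
  have : ∀ x, (S.controlOperator x p).ofLp i
      = ∑ j, (∑ l, (∑ k, S.G x i k * S.R k l) * S.G x j l) * p.ofLp j := by
    intro x
    have hp : (S.controlOperator x p).ofLp = (S.G x * S.R * (S.G x)ᵀ) *ᵥ p.ofLp := rfl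
    simp [hp, Matrix.mulVec, dotProduct, Matrix.mul_apply]
  simp only [this]
  refine ContDiff.sum fun j _ => ContDiff.mul (ContDiff.sum fun l _ => ContDiff.mul
    (ContDiff.sum fun k _ => (S.contDiff_G i k).mul contDiff_const) (S.contDiff_G j l))
    contDiff_const

theorem hasFDerivAt_controlOperator (x : Vec dx) :
    HasFDerivAt S.controlOperator (fderiv ℝ S.controlOperator x) x :=
  (S.contDiff_controlOperator.differentiable (by norm_num) x).hasFDerivAt

theorem inner_gradient_weightedNormSq (x p y : Vec dx) :
    inner ℝ (gradient (fun u => weightedNormSq S.R (S.RGt u p)) x) y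
      = inner ℝ p (fderiv ℝ S.controlOperator x y p) := by
  rw [inner_gradient_left]
  simp only [weightedNormSq_RGt]
  have h := (hasFDerivAt_const p x).inner ℝ
    ((S.hasFDerivAt_controlOperator x).clm_apply (hasFDerivAt_const p x))
  rw [h.fderiv]
  simp

/-- Symmetry of the control operator makes the two terms in which the momentum is differentiated
equal, which absorbs the factor `1/2` and produces the closed-loop drift. -/
theorem differentiableAt_hjbRHS_and_fderiv_apply {g : Vec dx → ℝ} (hg : ContDiff ℝ 3 g)
    (x : Vec dx) :
    DifferentiableAt ℝ (S.hjbRHS g) x ∧ ∀ y, fderiv ℝ (S.hjbRHS g) x y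
      = inner ℝ (gradient g x) (fderiv ℝ S.b x y)
        + fderiv ℝ (fderiv ℝ g) x (S.b x - S.GRGt x (gradient g x)) y
        + 1 / 2 * fderiv ℝ (frobHess S.Sig g) x y + fderiv ℝ S.c x y
        - 1 / 2 * inner ℝ (gradient g x) (fderiv ℝ S.controlOperator x y (gradient g x)) := by
  have hq : HasFDerivAt (gradient g) (fderiv ℝ (gradient g) x) x :=
    ((hg.contDiff_gradient (k := 2) (by norm_num)).differentiable (by norm_num) x).hasFDerivAt
  have hb := (S.contDiff_b.differentiable (by norm_num) x).hasFDerivAt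
  have hc := (S.contDiff_c.differentiable (by norm_num) x).hasFDerivAt
  have hH := (hg.differentiable_frobHess S.Sig x).hasFDerivAt
  have h := (((hb.inner ℝ hq).add (hH.const_mul (1 / 2))).add hc).sub
    ((hq.inner ℝ ((S.hasFDerivAt_controlOperator x).clm_apply hq)).const_mul (1 / 2))
  have heq : S.hjbRHS g = fun u => inner ℝ (S.b u) (gradient g u) + (1 / 2) * frobHess S.Sig g u
      + S.c u - (1 / 2) * inner ℝ (gradient g u) (S.controlOperator u (gradient g u)) := by
    funext u
    rw [hjbRHS, weightedNormSq_RGt]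
  have h' : HasFDerivAt (S.hjbRHS g) _ x :=
    h.congr_of_eventuallyEq (Filter.Eventually.of_forall fun u => by rw [heq]; rfl)
  refine ⟨h'.differentiableAt, fun y => ?_⟩
  have hg2 : ContDiff ℝ 2 g := hg.of_le (by norm_num)
  have s1 : inner ℝ (S.b x) (fderiv ℝ (gradient g) x y) = fderiv ℝ (fderiv ℝ g) x (S.b x) y := by
    rw [real_inner_comm, inner_fderiv_gradient hg2, hg2.fderiv_fderiv_comm]
  have s2 : inner ℝ (fderiv ℝ (gradient g) x y) (S.controlOperator x (gradient g x))
      = fderiv ℝ (fderiv ℝ g) x (S.GRGt x (gradient g x)) y := by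
    rw [inner_fderiv_gradient hg2, hg2.fderiv_fderiv_comm, controlOperator_apply]
  have s3 : inner ℝ (gradient g x) (S.controlOperator x (fderiv ℝ (gradient g) x y))
      = fderiv ℝ (fderiv ℝ g) x (S.GRGt x (gradient g x)) y := by
    rw [← inner_controlOperator_comm, real_inner_comm, s2]
  rw [h'.fderiv, map_sub, _root_.sub_apply]
  simp [fderivInnerCLM_apply, inner_add_right, s1, s2, s3, real_inner_comm (fderiv ℝ S.b x y)]
  ring

/-- With `M` the symmetric control operator, `p·Mp - q·Mq = (p - q)·M(p + q)`. -/
theorem hjbRHS_sub {g h : Vec dx → ℝ} (hg : ContDiff ℝ 2 g) (hh : ContDiff ℝ 2 h) (x : Vec dx) :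
    S.hjbRHS g x - S.hjbRHS h x = generator S.Sig (S.b x - (1 / 2 : ℝ) •
      (S.GRGt x (gradient g x) + S.GRGt x (gradient h x))) (fun u => g u - h u) x := by
  have hgen := generator_linear_combination (A := S.Sig) hg hh 1 (-1) (S.b x - (1 / 2 : ℝ) •
      (S.GRGt x (gradient g x) + S.GRGt x (gradient h x))) x
  have heq : (fun u => 1 * g u + -1 * h u) = fun u => g u - h u := by
    funext u; ring
  rw [heq] at hgen
  rw [hgen]
  simp only [hjbRHS, generator, weightedNormSq_RGt, ← inner_gradient_left, smul_eq_mul,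
    ← controlOperator_apply, inner_sub_right, inner_smul_right, inner_add_right]
  rw [real_inner_comm (gradient g x) (S.b x), real_inner_comm (gradient h x) (S.b x),
    ← S.inner_controlOperator_comm x (gradient g x) (gradient h x),
    real_inner_comm (S.controlOperator x (gradient g x)) (gradient h x)]
  ring

end ControlProblem

/-! ### Joint continuity for the potential -/

namespace IsRegularPotential

variable {dx : ℕ} {T : ℝ} {φ : ℝ → Vec dx → ℝ}

theorem continuousOn_fderiv_apply (hφ : IsRegularPotential T φ) (y : Vec dx) :
    ContinuousOn (fun z : ℝ × Vec dx => fderiv ℝ (φ z.1) z.2 y) (Icc 0 T ×ˢ univ) := by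
  have : (fun z : ℝ × Vec dx => fderiv ℝ (φ z.1) z.2 y)
      = fun z => inner ℝ (gradient (φ z.1) z.2) y := by
    funext z
    rw [inner_gradient_left]
  rw [this]
  exact hφ.continuousOn_gradient.inner continuousOn_const

theorem continuousOn_fderiv_fderiv_apply (hφ : IsRegularPotential T φ) (a b : Vec dx) :
    ContinuousOn (fun z : ℝ × Vec dx => fderiv ℝ (fderiv ℝ (φ z.1)) z.2 a b)
      (Ioo 0 T ×ˢ univ) := by
  have h : ContinuousOn (fun z : ℝ × Vec dx => iteratedFDeriv ℝ 2 (φ z.1) z.2 ![a, b])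
      (Ioo 0 T ×ˢ univ) :=
    (continuous_eval_const ![a, b]).comp_continuousOn hφ.continuousOn_second
  refine h.congr fun z _ => ?_
  simp [iteratedFDeriv_two_apply]

theorem continuousOn_fderiv_fderiv (hφ : IsRegularPotential T φ) :
    ContinuousOn (fun z : ℝ × Vec dx => fderiv ℝ (fderiv ℝ (φ z.1)) z.2) (Ioo 0 T ×ˢ univ) := by
  rw [continuousOn_clm_apply]
  intro a
  rw [continuousOn_clm_apply]
  exact hφ.continuousOn_fderiv_fderiv_apply a

theorem continuousOn_fderiv_frobHess (hφ : IsRegularPotential T φ)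
    (A : Matrix (Fin dx) (Fin dx) ℝ) (y : Vec dx) :
    ContinuousOn (fun z : ℝ × Vec dx => fderiv ℝ (frobHess A (φ z.1)) z.2 y)
      (Ioo 0 T ×ˢ univ) := by
  have h : ContinuousOn (fun z : ℝ × Vec dx => ∑ i, ∑ j, A i j * iteratedFDeriv ℝ 3 (φ z.1) z.2
      ![EuclideanSpace.single i (1 : ℝ), EuclideanSpace.single j (1 : ℝ), y])
      (Ioo 0 T ×ˢ univ) := by
    refine continuousOn_finsetSum _ fun i _ => continuousOn_finsetSum _ fun j _ => ?_
    exact continuousOn_const.mul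
      ((continuous_eval_const _).comp_continuousOn hφ.continuousOn_third)
  exact h.congr fun z hz => (hφ.contDiff z.1 hz.1).fderiv_frobHess_eq_sum A z.2 y

theorem continuousOn_fderiv_hjbRHS {du : ℕ} (hφ : IsRegularPotential T φ)
    (S : ControlProblem dx du) (y : Vec dx) :
    ContinuousOn (fun z : ℝ × Vec dx => fderiv ℝ (S.hjbRHS (φ z.1)) z.2 y)
      (Ioo 0 T ×ˢ univ) := by
  have hq : ContinuousOn (fun z : ℝ × Vec dx => gradient (φ z.1) z.2) (Ioo 0 T ×ˢ univ) :=
    hφ.continuousOn_gradient.mono (prod_mono Ioo_subset_Icc_self subset_rfl)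
  have hb : Continuous fun z : ℝ × Vec dx => S.b z.2 := S.contDiff_b.continuous.comp continuous_snd
  have hDb : Continuous fun z : ℝ × Vec dx => fderiv ℝ S.b z.2 y :=
    ((S.contDiff_b.continuous_fderiv (by norm_num)).comp continuous_snd).clm_apply continuous_const
  have hDc : Continuous fun z : ℝ × Vec dx => fderiv ℝ S.c z.2 y :=
    ((S.contDiff_c.continuous_fderiv (by norm_num)).comp continuous_snd).clm_apply continuous_const
  have hM : Continuous fun z : ℝ × Vec dx => S.controlOperator z.2 :=
    S.contDiff_controlOperator.continuous.comp continuous_snd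
  have hDM : Continuous fun z : ℝ × Vec dx => fderiv ℝ S.controlOperator z.2 y :=
    ((S.contDiff_controlOperator.continuous_fderiv (by norm_num)).comp continuous_snd).clm_apply
      continuous_const
  have h := ((((hq.inner (𝕜 := ℝ) hDb.continuousOn).add
    ((hφ.continuousOn_fderiv_fderiv.clm_apply
      (hb.continuousOn.sub (hM.continuousOn.clm_apply hq))).clm_apply
      (continuousOn_const (c := y)))).add
    ((hφ.continuousOn_fderiv_frobHess S.Sig y).const_smul (1 / 2 : ℝ))).add
    hDc.continuousOn).sub
    ((hq.inner (𝕜 := ℝ) (hDM.continuousOn.clm_apply hq)).const_smul (1 / 2 : ℝ))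
  refine h.congr fun z hz => ?_
  rw [(S.differentiableAt_hjbRHS_and_fderiv_apply (hφ.contDiff z.1 hz.1) z.2).2]
  simp only [smul_eq_mul, ControlProblem.controlOperator_apply, Pi.sub_apply, Pi.add_apply,
    Pi.smul_apply]

/-- `φ_t` may jump in time by a constant, but a spatial difference is the integral of the jointly
continuous gradient over a segment. -/
theorem continuousOn_sub (hφ : IsRegularPotential T φ) :
    ContinuousOn (fun z : ℝ × Vec dx × Vec dx => φ z.1 z.2.1 - φ z.1 z.2.2)
      (Icc 0 T ×ˢ univ) := by
  rcases lt_or_ge T 0 with hT | hT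
  · simp [Icc_eq_empty (not_le.2 hT)]
  -- Clamping time to `[0, T]` makes the integrand continuous for all real times.
  let π : ℝ → ℝ := fun t => projIcc 0 T hT t
  have hπ : Continuous π := continuous_subtype_val.comp continuous_projIcc
  have hπmem : ∀ t, π t ∈ Icc 0 T := fun t => (projIcc 0 T hT t).2
  have hgrad : Continuous fun p : (ℝ × Vec dx × Vec dx) × ℝ =>
      gradient (φ (π p.1.1)) (p.1.2.2 + p.2 • (p.1.2.1 - p.1.2.2)) :=
    hφ.continuousOn_gradient.comp_continuous
      (f := fun p : (ℝ × Vec dx × Vec dx) × ℝ =>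
        (π p.1.1, p.1.2.2 + p.2 • (p.1.2.1 - p.1.2.2)))
      (by fun_prop) fun p => ⟨hπmem _, mem_univ _⟩
  have hint := intervalIntegral.continuous_parametric_intervalIntegral_of_continuous'
    (μ := MeasureTheory.volume)
    (f := fun (z : ℝ × Vec dx × Vec dx) (s : ℝ) => inner ℝ
      (gradient (φ (π z.1)) (z.2.2 + s • (z.2.1 - z.2.2))) (z.2.1 - z.2.2))
    (hgrad.inner (by fun_prop)) 0 1
  refine hint.continuousOn.congr fun z hz => ?_
  have hz1 : π z.1 = z.1 := by simp [π, projIcc_of_mem hT hz.1]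
  simp only [hz1, inner_gradient_left]
  rw [integral_fderiv_segment (hφ.differentiable z.1 hz.1)]
  exact (hφ.continuousOn_fderiv_apply _).comp_continuous (f := fun u => (z.1, u))
    (by fun_prop) fun u => ⟨hz.1, mem_univ _⟩

end IsRegularPotential

/-! ### Elimination of the gauge and comparison with the value function -/

namespace IsMeanFieldHamiltonianFlow

variable {dx du : ℕ} {S : ControlProblem dx du} {T : ℝ} {β X P : ℝ → Vec dx → Vec dx}
  {φ : ℝ → Vec dx → ℝ}

/-- The gauge variable cancels: the gradient of the potential satisfies the gradient of the HJB
equation. -/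
theorem hasDerivAt_fderiv_potential (hflow : IsMeanFieldHamiltonianFlow S T β X P φ)
    (hφ : IsRegularPotential T φ) {t : ℝ} (ht : t ∈ Ioo 0 T) (honto : Function.Surjective (X t))
    (x y : Vec dx) :
    HasDerivAt (fun s => fderiv ℝ (φ s) x y) (-fderiv ℝ (S.hjbRHS (φ t)) x y) t := by
  obtain ⟨a, rfl⟩ := honto x
  have hφt := hφ.contDiff t ht
  have hφ2 : ContDiff ℝ 2 (φ t) := hφt.of_le (by norm_num)
  have hnhds : Ioo 0 T ∈ nhds t := isOpen_Ioo.mem_nhds ht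
  have hPc : gradient (φ t) (X t a) = P t a := hflow.constraint t (Ioo_subset_Icc_self ht) a
  have hdir : ∀ s ∈ Ioo 0 T, ∀ u, fderiv ℝ (fun u => fderiv ℝ (φ s) u y) u
      = (fderiv ℝ (fderiv ℝ (φ s)) u).flip y := fun s hs u =>
    (((hφ.contDiff s hs).of_le (by norm_num)).hasFDerivAt_fderiv_apply u y).fderiv
  have hp : HasDerivAt (fun s => fderiv ℝ (φ s) (X s a) y) _ t :=
    ((hflow.eqn_P t ht a).inner ℝ (hasDerivAt_const t y)).congr_of_eventuallyEq (by
      filter_upwards [hnhds] with s hs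
      rw [← hflow.constraint s (Ioo_subset_Icc_self hs) a, inner_gradient_left])
  have hcont : ContinuousAt (fun z : ℝ × Vec dx => fderiv ℝ (fun u => fderiv ℝ (φ z.1) u y) z.2)
      (t, X t a) := by
    have h1 : ContinuousOn (fun z : ℝ × Vec dx => fderiv ℝ (fun u => fderiv ℝ (φ z.1) u y) z.2)
        (Ioo 0 T ×ˢ univ) := by
      rw [continuousOn_clm_apply]
      intro b
      refine (hφ.continuousOn_fderiv_fderiv_apply b y).congr fun z hz => ?_
      rw [hdir z.1 hz.1]
      rfl
    exact h1.continuousAt ((isOpen_Ioo.prod isOpen_univ).mem_nhds ⟨ht, mem_univ _⟩)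
  have h := hasDerivAt_of_hasDerivAt_along (g := fun s u => fderiv ℝ (φ s) u y)
    (hflow.eqn_X t ht a) hp (by
      filter_upwards [hnhds] with s hs
      exact ((hφ.contDiff s hs).contDiff_fderiv_apply_const y).differentiable (by norm_num)) hcont
  convert h using 1
  -- With `P` replaced by `∇φ`, the `β` terms from the two equations of motion cancel here.
  rw [(S.differentiableAt_hjbRHS_and_fderiv_apply hφt (X t a)).2 y, hdir t ht]
  simp only [generator, inner_zero_right, zero_add, inner_neg_left, inner_add_left, inner_sub_left,
    inner_smul_left, ContinuousLinearMap.adjoint_inner_left, S.inner_gradient_weightedNormSq,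
    inner_gradient_left, inner_fderiv_gradient hφ2, inner_frobHess_gradient hφt, hPc,
    ContinuousLinearMap.flip_apply, map_sub, _root_.sub_apply]
  simp
  ring

theorem hasDerivAt_potential_sub (hflow : IsMeanFieldHamiltonianFlow S T β X P φ)
    (hφ : IsRegularPotential T φ) (honto : ∀ t ∈ Icc 0 T, Function.Surjective (X t)) {t : ℝ}
    (ht : t ∈ Ioo 0 T) (x y : Vec dx) :
    HasDerivAt (fun s => φ s x - φ s y) (S.hjbRHS (φ t) y - S.hjbRHS (φ t) x) t := by
  have hslice : ∀ s ∈ Ioo 0 T, Continuous fun u => fderiv ℝ (φ s) u (x - y) := fun s hs =>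
    (hφ.continuousOn_fderiv_apply _).comp_continuous (f := fun u => (s, u))
      (by fun_prop) fun u => ⟨Ioo_subset_Icc_self hs, mem_univ _⟩
  have hcont := hφ.continuousOn_fderiv_hjbRHS S (x - y)
  have h := hasDerivAt_intervalIntegral_of_continuousOn (a := 0) (b := T)
    (f := fun s r => fderiv ℝ (φ s) (y + r • (x - y)) (x - y))
    (f' := fun s r => -fderiv ℝ (S.hjbRHS (φ s)) (y + r • (x - y)) (x - y))
    (fun s hs => (hslice s hs).comp (f := fun r : ℝ => y + r • (x - y)) (by fun_prop))
    (hcont.comp (f := fun z : ℝ × ℝ => (z.1, y + z.2 • (x - y))) (by fun_prop)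
      fun z hz => ⟨hz.1, mem_univ _⟩).neg
    (fun s hs r => hflow.hasDerivAt_fderiv_potential hφ hs
      (honto s (Ioo_subset_Icc_self hs)) _ _) ht
  rw [intervalIntegral.integral_neg, integral_fderiv_segment
    (fun u => (S.differentiableAt_hjbRHS_and_fderiv_apply (hφ.contDiff t ht) u).1) x y
    (hcont.comp_continuous (f := fun u => (t, u)) (by fun_prop) fun u => ⟨ht, mem_univ _⟩),
    neg_sub] at h
  refine h.congr_of_eventuallyEq ?_
  filter_upwards [isOpen_Ioo.mem_nhds ht] with s hs
  rw [integral_fderiv_segment (hφ.differentiable s (Ioo_subset_Icc_self hs)) _ _ (hslice s hs)]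

end IsMeanFieldHamiltonianFlow

theorem IsMeanFieldHamiltonianFlow.sub_eq_sub {dx du : ℕ} {S : ControlProblem dx du} {T : ℝ}
    (hT : 0 < T) {v : ℝ → Vec dx → ℝ} (hv : S.IsHJBSolution T v) (hvg : S.HasAdmissibleGrowth T v)
    {β X P : ℝ → Vec dx → Vec dx} {φ : ℝ → Vec dx → ℝ}
    (hφ : IsRegularPotential T φ) (hφg : S.HasAdmissibleGrowth T φ)
    (hflow : IsMeanFieldHamiltonianFlow S T β X P φ)
    (honto : ∀ t ∈ Icc 0 T, Function.Surjective (X t)) {t : ℝ} (ht : t ∈ Icc 0 T)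
    (x y : Vec dx) : v t x - φ t x = v t y - φ t y := by
  obtain ⟨K₁, m₁, h₁⟩ := hvg
  obtain ⟨K₂, m₂, h₂⟩ := hφg
  have hTmem : T ∈ Icc 0 T := ⟨hT.le, le_rfl⟩
  have hf : Differentiable ℝ S.f := S.contDiff_f.differentiable (by norm_num)
  have hterm : ∀ x y, v T x - φ T x = v T y - φ T y := by
    have hd : Differentiable ℝ fun u => S.f u - φ T u := hf.sub (hφ.differentiable T hTmem)
    intro x y
    rw [hv.terminal, hv.terminal]
    refine is_const_of_fderiv_eq_zero (𝕜 := ℝ) hd (fun u => ?_) x y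
    obtain ⟨a, rfl⟩ := honto T hTmem u
    rw [fderiv_fun_sub (hf _) (hφ.differentiable T hTmem _), ← toDual_gradient, ← toDual_gradient,
      hflow.constraint T hTmem, hflow.terminal, sub_self]
  have hvcont : ContinuousOn (fun z : ℝ × Vec dx × Vec dx => v z.1 z.2.1 - v z.1 z.2.2)
      (Icc 0 T ×ˢ univ) :=
    (hv.continuousOn.comp (f := fun z : ℝ × Vec dx × Vec dx => (z.1, z.2.1)) (by fun_prop)
      fun z hz => ⟨hz.1, mem_univ _⟩).sub
    (hv.continuousOn.comp (f := fun z : ℝ × Vec dx × Vec dx => (z.1, z.2.2)) (by fun_prop)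
      fun z hz => ⟨hz.1, mem_univ _⟩)
  have hcont : ContinuousOn (fun z : ℝ × Vec dx × Vec dx =>
      (v z.1 z.2.1 - φ z.1 z.2.1) - (v z.1 z.2.2 - φ z.1 z.2.2)) (Icc 0 T ×ˢ univ) :=
    (hvcont.sub hφ.continuousOn_sub).congr fun z _ => by simp only [Pi.sub_apply]; ring
  have hmono : ∀ {K K' ρ : ℝ} {k l : ℕ}, K ≤ K' → 0 ≤ K' → k ≤ l → 0 ≤ ρ →
      K * (1 + ρ) ^ k ≤ K' * (1 + ρ) ^ l := fun {K K' ρ k l} hK hK' hkl hρ =>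
    calc _ ≤ K' * (1 + ρ) ^ k := by gcongr
      _ ≤ _ := mul_le_mul_of_nonneg_left (pow_le_pow_right₀ (by linarith) hkl) hK'
  have hmain : ∀ s ∈ Ioo 0 T, ∀ x y, v s x - φ s x ≤ v s y - φ s y := by
    intro s hs x y
    refine eq_of_backward_parabolic (A := S.Sig) S.posSemidef_Sig (w := fun s u => v s u - φ s u)
      (μ := fun s u => S.b u - (1 / 2 : ℝ) •
        (S.GRGt u (gradient (v s) u) + S.GRGt u (gradient (φ s) u)))
      (K := |K₁| + |K₂|) (m := m₁ + m₂) hcont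
      (fun s hs => (hv.contDiff s hs).sub ((hφ.contDiff s hs).of_le (by norm_num)))
      (fun s hs u => ?_) (fun s hs u => ?_) (fun s hs x y => ?_) hterm hs x y
    · have hg : gradient (fun u => v s u - φ s u) u = gradient (v s) u - gradient (φ s) u := by
        refine ext_inner_right ℝ fun z => ?_
        rw [inner_sub_left, inner_gradient_left, inner_gradient_left, inner_gradient_left,
          fderiv_fun_sub ((hv.contDiff s hs).differentiable (by norm_num) u)
          (hφ.differentiable s (Ioo_subset_Icc_self hs) u)]
        rfl
      have e1 : K₁ * (1 + ‖u‖) ^ m₁ ≤ |K₁| * (1 + ‖u‖) ^ (m₁ + m₂) :=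
        hmono (le_abs_self _) (abs_nonneg _) (by omega) (norm_nonneg _)
      have e2 : K₂ * (1 + ‖u‖) ^ m₂ ≤ |K₂| * (1 + ‖u‖) ^ (m₁ + m₂) :=
        hmono (le_abs_self _) (abs_nonneg _) (by omega) (norm_nonneg _)
      rw [hg, add_mul]
      exact (norm_sub_le _ _).trans (add_le_add ((h₁ s hs u).1.trans e1) ((h₂ s hs u).1.trans e2))
    · have e1 := (h₁ s hs u).2
      have e2 := (h₂ s hs u).2
      have hpos : 0 ≤ 1 + ‖u‖ ^ 2 := by positivity
      have e3 : K₁ * (1 + ‖u‖ ^ 2) ≤ |K₁| * (1 + ‖u‖ ^ 2) := by gcongr; exact le_abs_self _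
      have e4 : K₂ * (1 + ‖u‖ ^ 2) ≤ |K₂| * (1 + ‖u‖ ^ 2) := by gcongr; exact le_abs_self _
      have e5 := mul_nonneg (abs_nonneg K₁) hpos
      have e6 := mul_nonneg (abs_nonneg K₂) hpos
      simp only [inner_sub_right, inner_smul_right, inner_add_right] at e1 e2 ⊢
      linarith
    · have hd := ((hv.hjb s hs x).sub (hv.hjb s hs y)).sub
        (hflow.hasDerivAt_potential_sub hφ honto hs x y)
      have hφ2 : ContDiff ℝ 2 (φ s) := (hφ.contDiff s hs).of_le (by norm_num)
      rw [← S.hjbRHS_sub (hv.contDiff s hs) hφ2, ← S.hjbRHS_sub (hv.contDiff s hs) hφ2]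
      refine (hd.congr_deriv (by ring)).congr_of_eventuallyEq (Filter.Eventually.of_forall
        fun r => ?_)
      simp only [Pi.sub_apply]
      ring
  -- The maximum principle covers only `0 < t < T`; continuity of the differences reaches the
  -- endpoints.
  have hzero : EqOn (fun s => (v s x - φ s x) - (v s y - φ s y)) (fun _ => 0) (Icc 0 T) := by
    rw [← closure_Ioo hT.ne]
    refine EqOn.of_subset_closure (s := Ioo 0 T) (fun s hs => ?_) ?_ continuousOn_const
      subset_closure subset_rfl
    · exact sub_eq_zero.2 (le_antisymm (hmain s hs x y) (hmain s hs y x))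
    · rw [closure_Ioo hT.ne]
      exact hcont.comp (f := fun s : ℝ => (s, x, y)) (by fun_prop) fun s hs => ⟨hs, mem_univ _⟩
  exact sub_eq_zero.1 (hzero ht)

theorem theorem1 {dx du : ℕ} (S : ControlProblem dx du) (T : ℝ) (hT : 0 < T)
    (v : ℝ → Vec dx → ℝ) (hv : S.IsHJBSolution T v) (hvg : S.HasAdmissibleGrowth T v)
    (β X P : ℝ → Vec dx → Vec dx) (φ : ℝ → Vec dx → ℝ)
    (hφ : IsRegularPotential T φ) (hφg : S.HasAdmissibleGrowth T φ)
    (hflow : IsMeanFieldHamiltonianFlow S T β X P φ)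
    (honto : ∀ t ∈ Set.Icc 0 T, Function.Surjective (X t)) :
    ∀ t ∈ Set.Icc 0 T, ∀ x : Vec dx,
      DifferentiableAt ℝ (v t) x ∧ gradient (φ t) x = gradient (v t) x := by
  intro t ht x
  -- At `t = 0` and `t = T` differentiability of `v` is not assumed; it comes from that of `φ`.
  have h : v t = fun u => φ t u + (v t 0 - φ t 0) := by
    funext u
    have := hflow.sub_eq_sub hT hv hvg hφ hφg honto ht u 0
    linarith
  have hd := hφ.differentiable t ht x
  refine ⟨by rw [h]; exact hd.add_const _, ext_inner_right ℝ fun z => ?_⟩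
  rw [inner_gradient_left, inner_gradient_left, h, fderiv_add_const]
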